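/- Let $M$ be a smooth four-dimensional manifold with a smooth metric $h$ of neutral signature $(+,+,-,-)$, oriented, and let $\nabla$ be the Levi-Civita connection of $h$. An $\alpha$-plane (respectively $\beta$-plane) is a totally null two-dimensional subspace $P\subset T_xM$ which is self-dual (respectively anti-self-dual), i.e. $\star(u\wedge v)=u\wedge v$ (respectively $\star(u\wedge v)=-u\wedge v$) for $u,v\in P$. A distribution $E\subseteq TM$ is integrable if $[X,Y]\in E$ for all local smooth sections $X,Y$ of $E$, parallel if $\nabla_XY\in E$ for every local section $Y$ of $E$ and every vector field $X$, and auto-parallel if $\nabla_XY\in E$ for all local sections $X,Y$ of $E$. In terms of spinors, with $T_xM\cong S_x\otimes S'_x$, $h=\varepsilon\otimes\varepsilon'$, the $\alpha$-planes are $Z_{[\pi]}=\{\mu^A\pi^{A'}:\mu\in S_x\}$, $0\neq\pi\in S'_x$, and the $\beta$-planes are $W_{[\lambda]}=\{\lambda^A\nu^{A'}:\nu\in S'_x\}$, $0\neq\lambda\in S_x$. Let $Z$ be a smooth distribution of $\alpha$-planes and $W$ a smooth distribution of $\beta$-planes on $M$, so that pointwise $Z=Z_{[\pi]}$ and $W=W_{[\lambda]}$.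 Put $\mathcal D=Z\cap W$ and $\mathcal H=\mathcal D^\perp$. Then $\mathcal D=\langle\lambda^A\pi^{A'}\rangle_{\mathbf R}$ is a smooth null line distribution and $\mathcal H$ is a smooth distribution of rank three. Moreover: 1. If $Z$ and $W$ are both integrable (that is, $(M,h,Z,W)$ is an $\alpha\beta$-geometry), then $\mathcal D$ is auto-parallel. 2. If $Z$ and $W$ are both parallel (that is, $(M,h,Z,W)$ is a two-sided Walker geometry), then $\mathcal D$ and $\mathcal H$ are both parallel. -/

import Mathlib

open scoped Manifold ContDiff Bundle Topology TensorProduct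

namespace AlphaBeta

/-! ### Pseudo-Riemannian metrics and the Levi-Civita connection -/

section LeviCivita

/-- (Rough) vector fields on `M`; smoothness is imposed separately, on open sets. -/
abbrev VField {E : Type*} [NormedAddCommGroup E] [NormedSpace ℝ E] {H : Type*} [TopologicalSpace H]
    (I : ModelWithCorners ℝ E H) (M : Type*) [TopologicalSpace M] [ChartedSpace H M] : Type _ :=
  Π x : M, TangentSpace I x

/-- A smooth pseudo-Riemannian metric on the smooth manifold `M`: a smooth field of nondegenerate
symmetric bilinear forms on the tangent spaces. -/
structure PseudoMetric {E : Type*} [NormedAddCommGroup E] [NormedSpace ℝ E] {H : Type*}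
    [TopologicalSpace H] (I : ModelWithCorners ℝ E H) (M : Type*) [TopologicalSpace M]
    [ChartedSpace H M] [IsManifold I ∞ M] where
  /-- the bilinear form on each tangent space -/
  form : Π x : M, TangentSpace I x →L[ℝ] TangentSpace I x →L[ℝ] ℝ
  symm : ∀ (x : M) (v w : TangentSpace I x), form x v w = form x w v
  nondegenerate : ∀ (x : M) (v : TangentSpace I x), (∀ w, form x v w = 0) → v = 0
  contMDiff : ContMDiff I (I.prod 𝓘(ℝ, E →L[ℝ] E →L[ℝ] ℝ)) ∞
    (fun x : M ↦ Bundle.TotalSpace.mk' (E →L[ℝ] E →L[ℝ] ℝ)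
      (E := fun x : M ↦ TangentSpace I x →L[ℝ] TangentSpace I x →L[ℝ] ℝ) x (form x))

variable {E : Type*} [NormedAddCommGroup E] [NormedSpace ℝ E]
  {H : Type*} [TopologicalSpace H] {I : ModelWithCorners ℝ E H}
  {M : Type*} [TopologicalSpace M] [ChartedSpace H M] [IsManifold I ∞ M]

/-- The vector field `X` is smooth on the set `U` (its values outside `U` are irrelevant). -/
abbrev SmoothOn (X : VField I M) (U : Set M) : Prop :=
  ContMDiffOn I I.tangent ∞ (fun x ↦ (⟨x, X x⟩ : TangentBundle I M)) U

/-- The vector field `X` is differentiable at the point `x`. -/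
abbrev DiffAt (X : VField I M) (x : M) : Prop :=
  MDifferentiableAt I I.tangent (fun y ↦ (⟨y, X y⟩ : TangentBundle I M)) x

lemma exists_dual_aux {V : Type*} [NormedAddCommGroup V] [NormedSpace ℝ V] [FiniteDimensional ℝ V]
    (g f : V →L[ℝ] V →L[ℝ] ℝ) (hg : ∀ v, (∀ w, g v w = 0) → v = 0) :
    ∃ A : V →L[ℝ] V, ∀ v w, g (A v) w = f v w := by
  let B : V →ₗ[ℝ] Module.Dual ℝ V := (ContinuousLinearMap.coeLM ℝ).comp g.toLinearMap
  have hB : Function.Injective B := by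
    rw [← LinearMap.ker_eq_bot, LinearMap.ker_eq_bot']
    exact fun v hv ↦ hg v fun w ↦ LinearMap.congr_fun hv w
  let e := LinearEquiv.ofInjectiveOfFinrankEq B hB (Subspace.dual_finrank_eq).symm
  refine ⟨LinearMap.toContinuousLinearMap
    (e.symm.toLinearMap ∘ₗ (ContinuousLinearMap.coeLM ℝ).comp f.toLinearMap), fun v w ↦ ?_⟩
  have : B (e.symm (f v : V →ₗ[ℝ] ℝ)) = (f v : V →ₗ[ℝ] ℝ) := e.apply_symm_apply _
  exact LinearMap.congr_fun this w

namespace PseudoMetric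

variable (h : PseudoMetric I M)

/-- A connection is a Levi-Civita connection of `h` if it is torsion-free and metric:
`v (h(Y, Z)) = h(∇_v Y, Z) + h(Y, ∇_v Z)`.  Mathlib writes `cov Y x v` for `∇_v Y`. -/
structure IsLeviCivita
    (cov : CovariantDerivative I E (TangentSpace I : M → Type _)) : Prop where
  torsion_free : ∀ {x : M} {X Y : VField I M}, DiffAt X x → DiffAt Y x →
    cov Y x (X x) - cov X x (Y x) = VectorField.mlieBracket I X Y x
  metric : ∀ {x : M} {Y Z : VField I M} (v : TangentSpace I x), DiffAt Y x → DiffAt Z x →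
    mvfderiv I (fun y ↦ h.form y (Y y) (Z y)) x v
      = h.form x (cov Y x v) (Z x) + h.form x (Y x) (cov Z x v)

lemma mdifferentiableAt {x : M} {Y Z : VField I M} (hY : DiffAt Y x) (hZ : DiffAt Z x) :
    MDifferentiableAt I 𝓘(ℝ) (fun y ↦ h.form y (Y y) (Z y)) x := by
  have : MDifferentiableAt I (I.prod 𝓘(ℝ))
      (fun m ↦ Bundle.TotalSpace.mk' ℝ (E := Bundle.Trivial M ℝ) m (h.form m (Y m) (Z m))) x := by
    apply MDifferentiableAt.clm_bundle_apply₂ (F₁ := E) (F₂ := E)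
    · exact (h.contMDiff.mdifferentiableAt (by simp))
    · exact hY
    · exact hZ
  simp only [mdifferentiableAt_totalSpace] at this
  exact this.2

lemma diffAt_extend {x : M} (v : TangentSpace I x) :
    DiffAt (FiberBundle.extend E v : VField I M) x := by
  have : IsManifold I 2 M := .of_le (n := ∞) ENat.LEInfty.out
  exact FiberBundle.mdifferentiableAt_extend ..

lemma ext_form {x : M} {u u' : TangentSpace I x}
    (H : ∀ Z : VField I M, DiffAt Z x → 2 * h.form x u (Z x) = 2 * h.form x u' (Z x)) : u = u' := by
  rw [← sub_eq_zero]
  refine h.nondegenerate x _ fun w ↦ ?_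
  have := H (FiberBundle.extend E w) (diffAt_extend w)
  rw [FiberBundle.extend_apply_self] at this
  simp only [map_sub, sub_apply]
  linarith

variable [FiniteDimensional ℝ E]

lemma exists_dual (x : M) (f : TangentSpace I x →L[ℝ] TangentSpace I x →L[ℝ] ℝ) :
    ∃ A : TangentSpace I x →L[ℝ] TangentSpace I x, ∀ v w, h.form x (A v) w = f v w :=
  exists_dual_aux (V := E) (h.form x) f (h.nondegenerate x)

open VectorField

/-- Twice the right-hand side of the Koszul formula. -/
noncomputable def koszul (Y X Z : VField I M) (x : M) : ℝ :=
  mvfderiv I (fun y ↦ h.form y (Y y) (Z y)) x (X x)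
    + mvfderiv I (fun y ↦ h.form y (X y) (Z y)) x (Y x)
    - mvfderiv I (fun y ↦ h.form y (X y) (Y y)) x (Z x)
    + h.form x (mlieBracket I X Y x) (Z x)
    - h.form x (mlieBracket I X Z x) (Y x)
    - h.form x (mlieBracket I Y Z x) (X x)

lemma koszul_tensorial₁ {x : M} {Y Z : VField I M} (hY : DiffAt Y x) (hZ : DiffAt Z x) :
    TensorialAt I E (fun X : VField I M ↦ h.koszul Y X Z x) x where
  smul {f X} hf hX := by
    have : IsManifold I 2 M := .of_le (n := ∞) ENat.LEInfty.out
    have e1 := mvfderiv_fun_mul hf (h.mdifferentiableAt hX hZ)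
    have e2 := mvfderiv_fun_mul hf (h.mdifferentiableAt hX hY)
    simp [koszul, mlieBracket_smul_left hf hX, e1, e2, h.symm x (X x)]
    ring
  add {X X'} hX hX' := by
    have : IsManifold I 2 M := .of_le (n := ∞) ENat.LEInfty.out
    have e1 := mvfderiv_fun_add (h.mdifferentiableAt hX hZ) (h.mdifferentiableAt hX' hZ)
    have e2 := mvfderiv_fun_add (h.mdifferentiableAt hX hY) (h.mdifferentiableAt hX' hY)
    simp [koszul, mlieBracket_add_left hX hX', e1, e2]
    ring

lemma koszul_tensorial₂ {x : M} {Y X : VField I M} (hY : DiffAt Y x) (hX : DiffAt X x) :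
    TensorialAt I E (fun Z : VField I M ↦ h.koszul Y X Z x) x where
  smul {f Z} hf hZ := by
    have : IsManifold I 2 M := .of_le (n := ∞) ENat.LEInfty.out
    have e1 := mvfderiv_fun_mul hf (h.mdifferentiableAt hX hZ)
    have e2 := mvfderiv_fun_mul hf (h.mdifferentiableAt hY hZ)
    simp [koszul, mlieBracket_smul_right hf hZ, e1, e2, h.symm x (Z x)]
    ring
  add {Z Z'} hZ hZ' := by
    have : IsManifold I 2 M := .of_le (n := ∞) ENat.LEInfty.out
    have e1 := mvfderiv_fun_add (h.mdifferentiableAt hX hZ) (h.mdifferentiableAt hX hZ')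
    have e2 := mvfderiv_fun_add (h.mdifferentiableAt hY hZ) (h.mdifferentiableAt hY hZ')
    simp [koszul, mlieBracket_add_right hZ hZ', e1, e2]
    ring

lemma koszul_add {x : M} {Y Y' X Z : VField I M} (hY : DiffAt Y x) (hY' : DiffAt Y' x)
    (hX : DiffAt X x) (hZ : DiffAt Z x) :
    h.koszul (Y + Y') X Z x = h.koszul Y X Z x + h.koszul Y' X Z x := by
  have : IsManifold I 2 M := .of_le (n := ∞) ENat.LEInfty.out
  have e1 := mvfderiv_fun_add (h.mdifferentiableAt hY hZ) (h.mdifferentiableAt hY' hZ)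
  have e2 := mvfderiv_fun_add (h.mdifferentiableAt hX hY) (h.mdifferentiableAt hX hY')
  simp [koszul, mlieBracket_add_right hY hY', mlieBracket_add_left hY hY', e1, e2]
  ring

lemma koszul_smul {x : M} {f : M → ℝ} {Y X Z : VField I M}
    (hf : MDifferentiableAt I 𝓘(ℝ) f x) (hY : DiffAt Y x) (hX : DiffAt X x)
    (hZ : DiffAt Z x) :
    h.koszul (f • Y) X Z x
      = f x * h.koszul Y X Z x + 2 * (mvfderiv I f x (X x) * h.form x (Y x) (Z x)) := by
  have : IsManifold I 2 M := .of_le (n := ∞) ENat.LEInfty.out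
  have e1 := mvfderiv_fun_mul hf (h.mdifferentiableAt hY hZ)
  have e2 := mvfderiv_fun_mul hf (h.mdifferentiableAt hX hY)
  simp [koszul, mlieBracket_smul_right hf hY, mlieBracket_smul_left hf hY, e1, e2,
    h.symm x (X x)]
  ring

lemma exists_leviCivita_at {x : M} {Y : VField I M} (hY : DiffAt Y x) :
    ∃ A : TangentSpace I x →L[ℝ] TangentSpace I x, ∀ X Z : VField I M,
      DiffAt X x → DiffAt Z x → 2 * h.form x (A (X x)) (Z x) = h.koszul Y X Z x := by
  have : IsManifold I 2 M := .of_le (n := ∞) ENat.LEInfty.out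
  obtain ⟨A, hA⟩ := h.exists_dual x ((1 / 2 : ℝ) •
    TensorialAt.mkHom₂ (I := I) (F := E) (F' := E) (fun X Z : VField I M ↦ h.koszul Y X Z x) x
      (fun Z hZ ↦ h.koszul_tensorial₁ hY hZ) (fun X hX ↦ h.koszul_tensorial₂ hY hX))
  refine ⟨A, fun X Z hX hZ ↦ ?_⟩
  rw [hA]
  have := TensorialAt.mkHom₂_apply (I := I) (F := E) (F' := E)
    (Φ := fun X Z : VField I M ↦ h.koszul Y X Z x)
    (fun Z hZ ↦ h.koszul_tensorial₁ hY hZ) (fun X hX ↦ h.koszul_tensorial₂ hY hX) hX hZ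
  simp only [smul_apply, smul_eq_mul]
  rw [this]
  ring

open Classical in
/-- The covariant derivative `v ↦ ∇_v Y` at `x` given by the Koszul formula (and the junk value `0`
if `Y` is not differentiable at `x`). -/
noncomputable def leviCivitaFun (Y : VField I M) (x : M) :
    TangentSpace I x →L[ℝ] TangentSpace I x :=
  if hY : DiffAt Y x then (h.exists_leviCivita_at hY).choose else 0

lemma leviCivitaFun_spec {x : M} {Y X Z : VField I M} (hY : DiffAt Y x) (hX : DiffAt X x)
    (hZ : DiffAt Z x) : 2 * h.form x (h.leviCivitaFun Y x (X x)) (Z x) = h.koszul Y X Z x := by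
  rw [leviCivitaFun, dif_pos hY]
  exact (h.exists_leviCivita_at hY).choose_spec X Z hX hZ

/-- The Levi-Civita connection of `h`. -/
noncomputable def leviCivita :
    CovariantDerivative I E (TangentSpace I : M → Type _) where
  toFun := h.leviCivitaFun
  isCovariantDerivativeOnUniv :=
    { add := by
        intro Y Y' x hY hY' _
        have : IsManifold I 2 M := .of_le (n := ∞) ENat.LEInfty.out
        ext1 v
        refine h.ext_form fun Z hZ ↦ ?_
        have e := FiberBundle.extend_apply_self (F := E) v
        have hX := diffAt_extend v
        have hs : DiffAt (Y + Y') x := mdifferentiableAt_add_section hY hY'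
        have h1 := h.leviCivitaFun_spec hY hX hZ
        have h2 := h.leviCivitaFun_spec hY' hX hZ
        have h3 := h.leviCivitaFun_spec hs hX hZ
        rw [h.koszul_add hY hY' hX hZ] at h3
        rw [e] at h1 h2 h3
        rw [h3, ← h1, ← h2]
        simp only [add_apply, map_add]
        ring
      leibniz := by
        intro Y g x hY hg _
        have : IsManifold I 2 M := .of_le (n := ∞) ENat.LEInfty.out
        ext1 v
        refine h.ext_form fun Z hZ ↦ ?_
        have e := FiberBundle.extend_apply_self (F := E) v
        have hX := diffAt_extend v
        have hs : DiffAt (g • Y) x := hg.smul_section hY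
        have h1 := h.leviCivitaFun_spec hY hX hZ
        have h3 := h.leviCivitaFun_spec hs hX hZ
        rw [h.koszul_smul hg hY hX hZ] at h3
        rw [e] at h1 h3
        rw [h3, ← h1]
        simp only [add_apply, smul_apply, map_add, map_smul,
          ContinuousLinearMap.smulRight_apply, smul_eq_mul]
        ring }

theorem isLeviCivita_leviCivita : h.IsLeviCivita h.leviCivita where
  torsion_free := by
    intro x X Y hX hY
    refine h.ext_form fun Z hZ ↦ ?_
    have h1 := h.leviCivitaFun_spec hY hX hZ
    have h2 := h.leviCivitaFun_spec hX hY hZ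
    have e : (fun y ↦ h.form y (X y) (Y y)) = fun y ↦ h.form y (Y y) (X y) := by
      ext y; exact h.symm y _ _
    have e1 : mlieBracket I Y X x = - mlieBracket I X Y x := mlieBracket_swap_apply
    change 2 * h.form x (h.leviCivitaFun Y x (X x) - h.leviCivitaFun X x (Y x)) (Z x) = _
    simp only [map_sub, sub_apply, mul_sub, h1, h2, koszul, e, e1, map_neg, neg_apply]
    ring
  metric := by
    intro x Y Z v hY hZ
    have h1 := h.leviCivitaFun_spec hY (diffAt_extend v) hZ
    have h2 := h.leviCivitaFun_spec hZ (diffAt_extend v) hY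
    have s : ∀ A B : VField I M, (fun y ↦ h.form y (A y) (B y)) = fun y ↦ h.form y (B y) (A y) := by
      intro A B; ext y; exact h.symm y _ _
    have e1 : mlieBracket I Z Y x = - mlieBracket I Y Z x := mlieBracket_swap_apply
    simp only [koszul, e1, map_neg, neg_apply] at h1 h2
    rw [s Z Y] at h2
    rw [FiberBundle.extend_apply_self] at h1 h2
    change _ = h.form x (h.leviCivitaFun Y x v) (Z x) + h.form x (Y x) (h.leviCivitaFun Z x v)
    rw [h.symm x (Y x)]
    linarith

end PseudoMetric

end LeviCivita

/-! ### Neutral metrics in dimension four -/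

/-- The model space of four-dimensional manifolds. -/
abbrev E4 : Type := EuclideanSpace ℝ (Fin 4)

/-- A smooth pseudo-Riemannian metric of neutral signature `(+,+,-,-)` on the smooth
four-manifold `M`: it has, at each point, a pseudo-orthonormal basis with two vectors of square `1`
and two of square `-1`. -/
structure NeutralMetric (M : Type*) [TopologicalSpace M] [ChartedSpace E4 M]
    [IsManifold (𝓡 4) ∞ M] extends PseudoMetric (𝓡 4) M where
  neutral : ∀ x : M, ∃ b : Module.Basis (Fin 4) ℝ (TangentSpace (𝓡 4) x),
    ∀ i j, form x (b i) (b j) = if i = j then (![1, 1, -1, -1] : Fin 4 → ℝ) i else 0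

variable {M : Type*} [TopologicalSpace M] [ChartedSpace E4 M] [IsManifold (𝓡 4) ∞ M]

/-! ### Distributions -/

/-- A field of tangent subspaces on `M`. -/
abbrev PlaneField (M : Type*) [TopologicalSpace M] [ChartedSpace E4 M] : Type _ :=
  Π x : M, Submodule ℝ (TangentSpace (𝓡 4) x)

/-- `X` is a smooth section of `D` over `U`. -/
def IsSectionOn (D : PlaneField M) (X : VField (𝓡 4) M) (U : Set M) : Prop :=
  SmoothOn X U ∧ ∀ x ∈ U, X x ∈ D x

/-- `D` is a smooth distribution of rank `k`: locally it has a smooth frame of `k` sections. -/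
def IsDistribution (k : ℕ) (D : PlaneField M) : Prop :=
  ∀ x₀ : M, ∃ U : Set M, IsOpen U ∧ x₀ ∈ U ∧ ∃ X : Fin k → VField (𝓡 4) M,
    (∀ i, SmoothOn (X i) U) ∧
    ∀ x ∈ U, LinearIndependent ℝ (fun i ↦ X i x) ∧
      Submodule.span ℝ (Set.range fun i ↦ X i x) = D x

/-- Integrability of a smooth distribution, as closure of its local sections under Lie brackets. -/
def IsIntegrable (D : PlaneField M) : Prop :=
  ∀ (U : Set M) (X Y : VField (𝓡 4) M), IsOpen U → IsSectionOn D X U → IsSectionOn D Y U →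
    ∀ x ∈ U, VectorField.mlieBracket (𝓡 4) X Y x ∈ D x

namespace NeutralMetric

variable (h : NeutralMetric M)

/-- `D` is parallel: `∇_v Y ∈ D` for all local sections `Y` of `D` and all tangent vectors `v`. -/
def IsParallel (D : PlaneField M) : Prop :=
  ∀ (U : Set M) (Y : VField (𝓡 4) M), IsOpen U → IsSectionOn D Y U →
    ∀ x ∈ U, ∀ v : TangentSpace (𝓡 4) x, h.leviCivita Y x v ∈ D x

/-- `D` is auto-parallel: `∇_v Y ∈ D` for all local sections `Y` of `D` and all `v ∈ D`
(equivalently, `∇_X Y ∈ D` for all local sections `X`, `Y` of `D`). -/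
def IsAutoParallel (D : PlaneField M) : Prop :=
  ∀ (U : Set M) (Y : VField (𝓡 4) M), IsOpen U → IsSectionOn D Y U →
    ∀ x ∈ U, ∀ v ∈ D x, h.leviCivita Y x v ∈ D x

/-- The orthogonal complement `D^⊥` of a field of tangent subspaces. -/
def orthogonal (D : PlaneField M) : PlaneField M := fun x ↦
  { carrier := {v | ∀ w ∈ D x, h.form x v w = 0}
    add_mem' := fun {a b} ha hb w hw ↦ by simp [ha w hw, hb w hw]
    zero_mem' := fun w _ ↦ by simp
    smul_mem' := fun c a ha w hw ↦ by simp [ha w hw] }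

/-- The subspace `P` of `T_x M` is totally null. -/
def IsTotallyNull (x : M) (P : Submodule ℝ (TangentSpace (𝓡 4) x)) : Prop :=
  ∀ u ∈ P, ∀ v ∈ P, h.form x u v = 0

/-- An orientation of `M`, given by the corresponding metric volume form `vol` of `h`: the smooth
`4`-form with `vol(v₁,…,v₄)² = det (h(vᵢ,vⱼ))`, that is, with value `±1` on pseudo-orthonormal
bases (a basis on which it is positive is positively oriented). -/
structure VolumeForm where
  /-- the alternating `4`-form on each tangent space -/
  form : Π x : M, TangentSpace (𝓡 4) x [⋀^Fin 4]→ₗ[ℝ] ℝ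
  sq_eq : ∀ (x : M) (v : Fin 4 → TangentSpace (𝓡 4) x),
    form x v ^ 2 = (Matrix.of fun i j ↦ h.form x (v i) (v j)).det
  smooth : ∀ (U : Set M) (X : Fin 4 → VField (𝓡 4) M), IsOpen U → (∀ i, SmoothOn (X i) U) →
    ContMDiffOn (𝓡 4) 𝓘(ℝ) ∞ (fun x ↦ form x fun i ↦ X i x) U

end NeutralMetric

/-! ### Alpha-planes and beta-planes -/

section

variable {h : NeutralMetric M} (vol : h.VolumeForm)

/-- An `α`-plane: a totally null `2`-plane which is self-dual, i.e. the bivectors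
`F = u ∧ v`, `u, v ∈ P`, satisfy `⋆F = F`.  Here `F_{ab} = h(u,a) h(v,b) - h(v,a) h(u,b)` and
`(⋆F)_{ab} = ½ vol_{abcd} F^{cd} = vol(a,b,u,v)`. -/
structure IsAlphaPlane (x : M) (P : Submodule ℝ (TangentSpace (𝓡 4) x)) : Prop where
  finrank_eq : Module.finrank ℝ P = 2
  null : h.IsTotallyNull x P
  selfDual : ∀ u ∈ P, ∀ v ∈ P, ∀ a b : TangentSpace (𝓡 4) x,
    vol.form x ![a, b, u, v] = h.form x u a * h.form x v b - h.form x v a * h.form x u b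

/-- A `β`-plane: a totally null `2`-plane which is anti-self-dual (`⋆(u ∧ v) = -(u ∧ v)`). -/
structure IsBetaPlane (x : M) (P : Submodule ℝ (TangentSpace (𝓡 4) x)) : Prop where
  finrank_eq : Module.finrank ℝ P = 2
  null : h.IsTotallyNull x P
  antiSelfDual : ∀ u ∈ P, ∀ v ∈ P, ∀ a b : TangentSpace (𝓡 4) x,
    vol.form x ![a, b, u, v] = -(h.form x u a * h.form x v b - h.form x v a * h.form x u b)

/-- A smooth distribution of `α`-planes. -/
def IsAlphaDistribution (Z : PlaneField M) : Prop :=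
  IsDistribution 2 Z ∧ ∀ x, IsAlphaPlane vol x (Z x)

/-- A smooth distribution of `β`-planes. -/
def IsBetaDistribution (W : PlaneField M) : Prop :=
  IsDistribution 2 W ∧ ∀ x, IsBetaPlane vol x (W x)

/-- `(M, h)`, with orientation `vol`, is an `αβ`-geometry with `α`-distribution `Z` and
`β`-distribution `W`: both are integrable. -/
structure IsAlphaBetaGeometry (Z W : PlaneField M) : Prop where
  alpha : IsAlphaDistribution vol Z
  beta : IsBetaDistribution vol W
  integrable_alpha : IsIntegrable Z
  integrable_beta : IsIntegrable W

/-- `(M, h)`, with orientation `vol`, is a two-sided Walker geometry with `α`-distribution `Z` and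
`β`-distribution `W`: both are parallel. -/
structure IsTwoSidedWalker (Z W : PlaneField M) : Prop where
  alpha : IsAlphaDistribution vol Z
  beta : IsBetaDistribution vol W
  parallel_alpha : h.IsParallel Z
  parallel_beta : h.IsParallel W

/-! ### Spinors -/

/-- The symplectic form on the two-dimensional space of spinors, in components. -/
def eps (a b : Fin 2 → ℝ) : ℝ := a 0 * b 1 - a 1 * b 0

/-- A pair of normalized spin frames at `x`.  It identifies the spaces `S_x` and `S'_x` of unprimed
and primed spinors with `ℝ²`, and amounts to an isomorphism `S ⊗ S' ≅ T_x M` (unprimed factor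
first) under which `h = ε ⊗ ε'`, compatible with the orientation in such a way that the planes
`S ⊗ π` are the self-dual ones. -/
structure SpinFrame (x : M) where
  /-- the isomorphism `S ⊗ S' ≅ T_x M` -/
  toEquiv : (Fin 2 → ℝ) ⊗[ℝ] (Fin 2 → ℝ) ≃ₗ[ℝ] TangentSpace (𝓡 4) x
  metric : ∀ l p l' p' : Fin 2 → ℝ,
    h.form x (toEquiv (l ⊗ₜ[ℝ] p)) (toEquiv (l' ⊗ₜ[ℝ] p')) = eps l l' * eps p p'
  oriented : vol.form x ![toEquiv (![1, 0] ⊗ₜ[ℝ] ![1, 0]), toEquiv (![0, 1] ⊗ₜ[ℝ] ![1, 0]),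
    toEquiv (![1, 0] ⊗ₜ[ℝ] ![0, 1]), toEquiv (![0, 1] ⊗ₜ[ℝ] ![0, 1])] = 1

namespace SpinFrame

variable {vol} {x : M} (σ : SpinFrame vol x)

/-- The tangent vector `l^A p^{A'}`. -/
noncomputable def vec (l p : Fin 2 → ℝ) : TangentSpace (𝓡 4) x := σ.toEquiv (l ⊗ₜ[ℝ] p)

/-- The plane `Z_{[p]} = {m^A p^{A'} : m ∈ S}`. -/
noncomputable def alphaPlane (p : Fin 2 → ℝ) : Submodule ℝ (TangentSpace (𝓡 4) x) :=
  Submodule.span ℝ (Set.range fun m ↦ σ.vec m p)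

/-- The plane `W_{[l]} = {l^A n^{A'} : n ∈ S'}`. -/
noncomputable def betaPlane (l : Fin 2 → ℝ) : Submodule ℝ (TangentSpace (𝓡 4) x) :=
  Submodule.span ℝ (Set.range fun n ↦ σ.vec l n)

end SpinFrame

lemma exists_spinFrame_aux {V : Type*} [AddCommGroup V] [Module ℝ V]
    (hfin : Module.finrank ℝ V = 4) (g : V →ₗ[ℝ] V →ₗ[ℝ] ℝ) (hsym : ∀ u v, g u v = g v u)
    (w : V [⋀^Fin 4]→ₗ[ℝ] ℝ)
    (hw : ∀ v : Fin 4 → V, w v ^ 2 = (Matrix.of fun i j ↦ g (v i) (v j)).det)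
    (b : Module.Basis (Fin 4) ℝ V)
    (hb : ∀ i j, g (b i) (b j) = if i = j then (![1, 1, -1, -1] : Fin 4 → ℝ) i else 0) :
    ∃ F : (Fin 2 → ℝ) ⊗[ℝ] (Fin 2 → ℝ) ≃ₗ[ℝ] V,
      (∀ l p l' p' : Fin 2 → ℝ, g (F (l ⊗ₜ[ℝ] p)) (F (l' ⊗ₜ[ℝ] p')) = eps l l' * eps p p') ∧
      w ![F (![1, 0] ⊗ₜ[ℝ] ![1, 0]), F (![0, 1] ⊗ₜ[ℝ] ![1, 0]),
        F (![1, 0] ⊗ₜ[ℝ] ![0, 1]), F (![0, 1] ⊗ₜ[ℝ] ![0, 1])] = 1 := by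
  -- a null tetrad with the right orientation gives a spin frame
  have key : ∀ e00 e10 e01 e11 : V,
      g e00 e00 = 0 → g e10 e10 = 0 → g e01 e01 = 0 → g e11 e11 = 0 →
      g e00 e10 = 0 → g e00 e01 = 0 → g e00 e11 = 1 →
      g e10 e01 = -1 → g e10 e11 = 0 → g e01 e11 = 0 →
      w ![e00, e10, e01, e11] = 1 → 
      ∃ F : (Fin 2 → ℝ) ⊗[ℝ] (Fin 2 → ℝ) ≃ₗ[ℝ] V,
        (∀ l p l' p' : Fin 2 → ℝ, g (F (l ⊗ₜ[ℝ] p)) (F (l' ⊗ₜ[ℝ] p')) = eps l l' * eps p p') ∧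
        w ![F (![1, 0] ⊗ₜ[ℝ] ![1, 0]), F (![0, 1] ⊗ₜ[ℝ] ![1, 0]),
          F (![1, 0] ⊗ₜ[ℝ] ![0, 1]), F (![0, 1] ⊗ₜ[ℝ] ![0, 1])] = 1 := by
    intro e00 e10 e01 e11 a1 a2 a3 a4 b1 b2 b3 b4 b5 b6 hv
    have c1 := (hsym e10 e00).trans b1
    have c2 := (hsym e01 e00).trans b2
    have c3 := (hsym e11 e00).trans b3
    have c4 := (hsym e01 e10).trans b4
    have c5 := (hsym e11 e10).trans b5
    have c6 := (hsym e11 e01).trans b6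
    let e : Fin 2 × Fin 2 → V := fun i ↦ !![e00, e01; e10, e11] i.1 i.2
    have hli : LinearIndependent ℝ e := by
      rw [Fintype.linearIndependent_iff]
      intro cf hg
      simp only [Fintype.sum_prod_type, Fin.sum_univ_two, e, Matrix.of_apply, Matrix.cons_val',
        Matrix.cons_val_zero, Matrix.cons_val_one, Matrix.cons_val_fin_one] at hg
      have g00 := congrArg (fun u : V ↦ g u e11) hg
      have g01 := congrArg (fun u : V ↦ g u e10) hg
      have g10 := congrArg (fun u : V ↦ g u e01) hg
      have g11 := congrArg (fun u : V ↦ g u e00) hg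
      simp [a1, a2, a3, a4, b1, b2, b3, b4, b5, b6, c1, c2, c3, c4, c5, c6]
        at g00 g01 g10 g11
      rintro ⟨i, j⟩
      fin_cases i <;> fin_cases j <;> simpa
    let be := basisOfLinearIndependentOfCardEqFinrank hli
      (show Fintype.card (Fin 2 × Fin 2) = Module.finrank ℝ V by simp [hfin])
    have hbe : ∀ i, be i = e i := fun i ↦
      congrFun (coe_basisOfLinearIndependentOfCardEqFinrank hli _) i
    let F := ((Pi.basisFun ℝ (Fin 2)).tensorProduct (Pi.basisFun ℝ (Fin 2))).equiv be
      (Equiv.refl _)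
    have hF : ∀ l p : Fin 2 → ℝ, F (l ⊗ₜ[ℝ] p)
        = (l 0 * p 0) • e00 + (l 0 * p 1) • e01 + (l 1 * p 0) • e10 + (l 1 * p 1) • e11 := by
      intro l p
      have h1 : ∀ i j, F (Pi.single i 1 ⊗ₜ[ℝ] Pi.single j 1) = e (i, j) := by
        intro i j
        rw [← hbe]
        have := ((Pi.basisFun ℝ (Fin 2)).tensorProduct (Pi.basisFun ℝ (Fin 2))).equiv_apply (i, j)
          be (Equiv.refl _)
        rwa [Module.Basis.tensorProduct_apply, Pi.basisFun_apply, Pi.basisFun_apply] at this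
      have hl : ∀ l : Fin 2 → ℝ, l = l 0 • Pi.single 0 1 + l 1 • Pi.single 1 1 := by
        intro l; ext i; fin_cases i <;> simp
      conv_lhs => rw [hl l, hl p]
      simp only [TensorProduct.add_tmul, TensorProduct.tmul_add, TensorProduct.smul_tmul_smul,
        map_add, map_smul, h1]
      simp [e]
      abel
    refine ⟨F, fun l p l' p' ↦ ?_, ?_⟩
    · simp only [hF, map_add, map_smul, LinearMap.add_apply, LinearMap.smul_apply, smul_eq_mul,
        a1, a2, a3, a4, b1, b2, b3, b4, b5, b6, c1, c2, c3, c4, c5, c6, eps]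
      ring
    · simpa [hF] using hv
  have hr : Real.sqrt 2 * Real.sqrt 2 = 2 := by norm_num
  set r : ℝ := (Real.sqrt 2)⁻¹ with hr_def
  have hrr : r * r = 1 / 2 := by
    rw [hr_def, ← mul_inv, hr]; norm_num
  set e00 := r • (b 0 + b 2)
  set e11 := r • (b 0 - b 2)
  set p := r • (b 1 + b 3)
  set q := r • (b 3 - b 1)
  have hH : ∀ i j, g (b i) (b j) =
    if i = j then (![1, 1, -1, -1] : Fin 4 → ℝ) i else 0 := hb
  have g1 : g e00 e00 = 0 := by simp [e00, hH]
  have g2 : g e11 e11 = 0 := by simp [e11, hH]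
  have g3 : g p p = 0 := by simp [p, hH]
  have g4 : g q q = 0 := by simp [q, hH]
  have g5 : g e00 e11 = 1 := by simp [e00, e11, hH]; linarith
  have g6 : g p q = -1 := by simp [p, q, hH]; linarith
  have g6' : g q p = -1 := by rw [hsym]; exact g6
  have g7 : g e00 p = 0 := by simp [e00, p, hH]
  have g8 : g e00 q = 0 := by simp [e00, q, hH]
  have g9 : g p e11 = 0 := by simp [p, e11, hH]
  have g10 : g q e11 = 0 := by simp [q, e11, hH]
  clear_value e00 e11 p q
  have hsq : w ![e00, p, q, e11] ^ 2 = 1 := by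
    rw [hw]
    have k1 := (hsym p e00).trans g7
    have k2 := (hsym q e00).trans g8
    have k3 := (hsym e11 e00).trans g5
    have k4 := (hsym e11 p).trans g9
    have k5 := (hsym e11 q).trans g10
    have hm : (Matrix.of fun i j : Fin 4 ↦
        g ((![e00, p, q, e11] : Fin 4 → V) i)
          ((![e00, p, q, e11] : Fin 4 → V) j))
        = !![0, 0, 0, 1; 0, 0, -1, 0; 0, -1, 0, 0; 1, 0, 0, 0] := by
      ext i j
      fin_cases i <;> fin_cases j <;>
        first | exact g1 | exact g2 | exact g3 | exact g4 | exact g5 | exact g6 | exact g6' |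
          exact g7 | exact g8 | exact g9 | exact g10 | exact k1 | exact k2 | exact k3 | exact k4 |
          exact k5
    rw [hm]
    simp [Matrix.det_succ_row_zero, Fin.sum_univ_succ, Fin.succAbove]
    norm_num
  have hswap : w ![e00, q, p, e11] = - w ![e00, p, q, e11] := by
    have := w.map_swap ![e00, p, q, e11] (show (1 : Fin 4) ≠ 2 by decide)
    rw [← this]
    congr 1
    ext i
    fin_cases i <;> simp [Equiv.swap_apply_def]
  rcases sq_eq_sq_iff_eq_or_eq_neg.1 (hsq.trans (one_pow 2).symm) with h1 | h1
  · exact key e00 p q e11 g1 g3 g4 g2 g7 g8 g5 g6 g9 g10 h1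
  · exact key e00 q p e11 g1 g4 g3 g2 g8 g7 g5 g6' g10 g9 (by rw [hswap, h1]; norm_num)

/-- Spin frames exist at every point. -/
theorem SpinFrame.nonempty (x : M) : Nonempty (SpinFrame vol x) := by
  obtain ⟨b, hb⟩ := h.neutral x
  obtain ⟨F, hF, hv⟩ := exists_spinFrame_aux (V := TangentSpace (𝓡 4) x)
    (show Module.finrank ℝ E4 = 4 by simp)
    (LinearMap.mk₂ ℝ (fun u v ↦ h.form x u v) (fun u v w ↦ by simp) (fun c u v ↦ by rw [map_smul]; rfl)
      (fun u v w ↦ by simp) (fun c u v ↦ map_smul (h.form x u) c v)) (h.symm x) (vol.form x)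
    (vol.sq_eq x) b hb
  exact ⟨⟨F, hF, hv⟩⟩

end

end AlphaBeta

namespace AlphaBeta

/-! ### The symplectic form on spinors -/

/-! The pointwise statements are spinor algebra. A null vector is a decomposable tensor, and two
decomposable vectors are orthogonal exactly when their unprimed or their primed factors are
proportional. Hence a totally null plane is `S ⊗ p` or `l ⊗ S'`
(`SpinFrame.eq_alphaPlane_or_eq_betaPlane`), and the orientation decides which family is self-dual.
The planes `S ⊗ p` and `l ⊗ S'` meet exactly in the line of `l ⊗ p`, so `Z ∩ W` has rank one
everywhere. Smoothness is obtained without smooth spinor fields: the metric pairings of local frames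
of `Z` and `W` are the coefficients of an explicit generator of the line
(`exists_frame_form_ne_zero`, `span_eq_inf`).

The differential statements rest on the fact that a totally null plane in dimension four equals its
own orthogonal complement. For sections `X`, `Y`, `T` of an integrable null distribution `Z`, each
term of the Koszul formula for `h(∇_X Y, T)` vanishes, so `∇_X Y` lies in `Z^⊥ = Z`
(`NeutralMetric.isAutoParallel_of_isIntegrable`). Being parallel or auto-parallel passes to
intersections, and metric compatibility carries parallelism over to orthogonal complements. -/

lemma eps_self (a : Fin 2 → ℝ) : eps a a = 0 := by simp only [eps]; ring

lemma exists_eps_eq_one {a : Fin 2 → ℝ} (ha : a ≠ 0) : ∃ b, eps a b = 1 := by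
  have : a 0 ≠ 0 ∨ a 1 ≠ 0 := by
    by_contra! H
    exact ha (by ext i; fin_cases i <;> simp [H.1, H.2])
  rcases this with h0 | h1
  · exact ⟨![0, (a 0)⁻¹], by simp [eps, h0]⟩
  · exact ⟨![-(a 1)⁻¹, 0], by simp [eps, h1]⟩

/-- By the cyclic identity `eps a d • b = eps b d • a + eps a b • d` in dimension two, choosing `d`
with `eps a d = 1` gives the factor `eps b d`. -/
lemma exists_smul_eq_of_eps_eq_zero {a b : Fin 2 → ℝ} (ha : a ≠ 0) (hab : eps a b = 0) :
    ∃ c : ℝ, b = c • a := by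
  obtain ⟨d, hd⟩ := exists_eps_eq_one ha
  refine ⟨eps b d, ?_⟩
  simp only [eps] at hab hd
  ext i
  fin_cases i
  · simp only [eps, Fin.zero_eta, Pi.smul_apply, smul_eq_mul]
    linear_combination (-(b 0)) * hd + d 0 * hab
  · simp only [eps, Fin.mk_one, Pi.smul_apply, smul_eq_mul]
    linear_combination (-(b 1)) * hd + d 1 * hab

/-- The value of an alternating form on the combinations of four vectors with coefficients `A`. -/
lemma map_sum_smul_eq_det {V : Type*} [AddCommGroup V] [Module ℝ V] (w : V [⋀^Fin 4]→ₗ[ℝ] ℝ)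
    (e : Fin 4 → V) (A : Fin 4 → Fin 4 → ℝ) :
    (w fun i ↦ ∑ j, A i j • e j) = (Matrix.of A).det * w e := by
  -- Pulled back along the coefficient map `ℝ⁴ → V`, the form becomes a top-degree form on `ℝ⁴`,
  -- hence a multiple of the determinant.
  have := DFunLike.congr_fun ((w.compLinearMap
    (Fintype.linearCombination ℝ e)).eq_smul_basis_det (Pi.basisFun ℝ (Fin 4))) A
  rw [AlternatingMap.smul_apply, Pi.basisFun_det_apply, AlternatingMap.compLinearMap_apply,
    AlternatingMap.compLinearMap_apply, smul_eq_mul] at this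
  simp only [Pi.basisFun_apply, Fintype.linearCombination_apply_single, one_smul] at this
  rw [mul_comm]
  exact this

variable {M : Type*} [TopologicalSpace M] [ChartedSpace E4 M] [IsManifold (𝓡 4) ∞ M]
  {h : NeutralMetric M} {vol : h.VolumeForm} {x : M}

omit [IsManifold (𝓡 4) ∞ M] in
lemma finrank_tangentSpace : Module.finrank ℝ (TangentSpace (𝓡 4) x) = 4 :=
  show Module.finrank ℝ E4 = 4 by simp

instance : FiniteDimensional ℝ (TangentSpace (𝓡 4) x) :=
  inferInstanceAs (FiniteDimensional ℝ E4)

/-! ### Spinor description of null vectors and totally null planes -/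

namespace SpinFrame

variable (σ : SpinFrame vol x)

lemma form_vec (l p l' p' : Fin 2 → ℝ) :
    h.form x (σ.vec l p) (σ.vec l' p') = eps l l' * eps p p' := σ.metric l p l' p'

lemma vec_add_left (l l' p : Fin 2 → ℝ) : σ.vec (l + l') p = σ.vec l p + σ.vec l' p := by
  simp [vec, TensorProduct.add_tmul]

lemma vec_smul_left (c : ℝ) (l p : Fin 2 → ℝ) : σ.vec (c • l) p = c • σ.vec l p := by
  rw [vec, ← TensorProduct.smul_tmul', map_smul]
  rfl

lemma vec_add_right (l p p' : Fin 2 → ℝ) : σ.vec l (p + p') = σ.vec l p + σ.vec l p' := by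
  simp [vec, TensorProduct.tmul_add]

lemma vec_smul_right (c : ℝ) (l p : Fin 2 → ℝ) : σ.vec l (c • p) = c • σ.vec l p := by
  simp [vec]

lemma vec_zero_left (p : Fin 2 → ℝ) : σ.vec 0 p = 0 := by simp [vec]

lemma vec_zero_right (l : Fin 2 → ℝ) : σ.vec l 0 = 0 := by simp [vec]

/-- The linear map `m ↦ m^A p^{A'}`. -/
noncomputable def vecLeft (p : Fin 2 → ℝ) : (Fin 2 → ℝ) →ₗ[ℝ] TangentSpace (𝓡 4) x where
  toFun m := σ.vec m p
  map_add' m m' := σ.vec_add_left m m' p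
  map_smul' c m := σ.vec_smul_left c m p

/-- The linear map `n ↦ l^A n^{A'}`. -/
noncomputable def vecRight (l : Fin 2 → ℝ) : (Fin 2 → ℝ) →ₗ[ℝ] TangentSpace (𝓡 4) x where
  toFun n := σ.vec l n
  map_add' n n' := σ.vec_add_right l n n'
  map_smul' c n := σ.vec_smul_right c l n

lemma alphaPlane_eq_range (p : Fin 2 → ℝ) : σ.alphaPlane p = LinearMap.range (σ.vecLeft p) := by
  rw [alphaPlane, ← Submodule.span_eq (LinearMap.range (σ.vecLeft p)), LinearMap.coe_range]
  rfl

lemma betaPlane_eq_range (l : Fin 2 → ℝ) : σ.betaPlane l = LinearMap.range (σ.vecRight l) := by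
  rw [betaPlane, ← Submodule.span_eq (LinearMap.range (σ.vecRight l)), LinearMap.coe_range]
  rfl

lemma mem_alphaPlane {p : Fin 2 → ℝ} {u : TangentSpace (𝓡 4) x} :
    u ∈ σ.alphaPlane p ↔ ∃ m, σ.vec m p = u := by
  rw [alphaPlane_eq_range]; rfl

lemma mem_betaPlane {l : Fin 2 → ℝ} {u : TangentSpace (𝓡 4) x} :
    u ∈ σ.betaPlane l ↔ ∃ n, σ.vec l n = u := by
  rw [betaPlane_eq_range]; rfl

lemma finrank_alphaPlane_le (p : Fin 2 → ℝ) : Module.finrank ℝ (σ.alphaPlane p) ≤ 2 := by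
  rw [alphaPlane_eq_range]
  simpa using LinearMap.finrank_range_le (σ.vecLeft p)

lemma finrank_betaPlane_le (l : Fin 2 → ℝ) : Module.finrank ℝ (σ.betaPlane l) ≤ 2 := by
  rw [betaPlane_eq_range]
  simpa using LinearMap.finrank_range_le (σ.vecRight l)

/-- Nondegeneracy of both symplectic forms provides a decomposable vector whose pairing with this
one is `1`. -/
lemma vec_ne_zero {l p : Fin 2 → ℝ} (hl : l ≠ 0) (hp : p ≠ 0) : σ.vec l p ≠ 0 := by
  intro H
  obtain ⟨l', hl'⟩ := exists_eps_eq_one hl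
  obtain ⟨p', hp'⟩ := exists_eps_eq_one hp
  have := σ.form_vec l p l' p'
  simp [H, hl', hp'] at this

lemma exists_eq_vec_add_vec (u : TangentSpace (𝓡 4) x) :
    ∃ a b, u = σ.vec ![1, 0] a + σ.vec ![0, 1] b := by
  obtain ⟨t, rfl⟩ := σ.toEquiv.surjective u
  induction t with
  | zero => exact ⟨0, 0, by simp [vec_zero_right]⟩
  | tmul l p =>
    refine ⟨l 0 • p, l 1 • p, ?_⟩
    rw [vec_smul_right, vec_smul_right, ← vec_smul_left, ← vec_smul_left, ← vec_add_left]
    change σ.vec l p = _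
    congr 1
    ext i
    fin_cases i <;> simp
  | add s t hs ht =>
    obtain ⟨a, b, h1⟩ := hs
    obtain ⟨a', b', h2⟩ := ht
    refine ⟨a + a', b + b', ?_⟩
    rw [map_add, h1, h2, vec_add_right, vec_add_right]
    abel

/-- A null vector is decomposable. -/
lemma exists_eq_vec_of_null {u : TangentSpace (𝓡 4) x} (hu : h.form x u u = 0) :
    ∃ l p, u = σ.vec l p := by
  obtain ⟨a, b, rfl⟩ := σ.exists_eq_vec_add_vec u
  by_cases ha : a = 0
  · exact ⟨![0, 1], b, by simp [ha, vec_zero_right]⟩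
  -- The square of `![1, 0] ⊗ a + ![0, 1] ⊗ b` is `2 * eps a b`; once `b = c • a`, the vector
  -- factors as `(![1, 0] + c • ![0, 1]) ⊗ a`.
  · have hab : eps a b = 0 := by
      simp only [map_add, add_apply, form_vec, eps_self] at hu
      simp [eps] at hu ⊢
      linarith
    obtain ⟨c, rfl⟩ := exists_smul_eq_of_eps_eq_zero ha hab
    exact ⟨![1, 0] + c • ![0, 1], a, by simp only [vec_add_left, vec_smul_left, vec_smul_right]⟩

/-- A totally null plane is of one of the two types `S ⊗ p` and `l ⊗ S'`. -/
lemma eq_alphaPlane_or_eq_betaPlane {P : Submodule ℝ (TangentSpace (𝓡 4) x)}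
    (hP : Module.finrank ℝ P = 2) (hn : h.IsTotallyNull x P) :
    (∃ p, p ≠ 0 ∧ P = σ.alphaPlane p) ∨ ∃ l, l ≠ 0 ∧ P = σ.betaPlane l := by
  let b := Module.finBasisOfFinrankEq ℝ P hP
  have hspan : ∀ Q : Submodule ℝ (TangentSpace (𝓡 4) x), (b 0 : TangentSpace (𝓡 4) x) ∈ Q →
      (b 1 : TangentSpace (𝓡 4) x) ∈ Q → P ≤ Q := by
    intro Q h0 h1 u hu
    have := congrArg (Subtype.val) (b.sum_repr ⟨u, hu⟩)
    change _ = u at this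
    rw [← this]
    simp only [Fin.sum_univ_two, Submodule.coe_add, Submodule.coe_smul]
    exact Q.add_mem (Q.smul_mem _ h0) (Q.smul_mem _ h1)
  have hne : (b 0 : TangentSpace (𝓡 4) x) ≠ 0 := by simpa using b.ne_zero 0
  obtain ⟨m, p, h0⟩ := σ.exists_eq_vec_of_null (hn _ (b 0).2 _ (b 0).2)
  obtain ⟨m', p', h1⟩ := σ.exists_eq_vec_of_null (hn _ (b 1).2 _ (b 1).2)
  have h01 := hn _ (b 0).2 _ (b 1).2
  have hm : m ≠ 0 := by rintro rfl; exact hne (by rw [h0, vec_zero_left])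
  have hp : p ≠ 0 := by rintro rfl; exact hne (by rw [h0, vec_zero_right])
  -- Orthogonality of the two decomposable basis vectors makes one pair of factors proportional; the
  -- shared factor determines the family, and the dimension bound turns inclusion into equality.
  rw [h0, h1, form_vec, mul_eq_zero] at h01
  rcases h01 with h01 | h01
  · obtain ⟨c, rfl⟩ := exists_smul_eq_of_eps_eq_zero hm h01
    refine .inr ⟨m, hm, Submodule.eq_of_le_of_finrank_le (hspan _ ?_ ?_)
      (hP ▸ σ.finrank_betaPlane_le m)⟩
    · exact σ.mem_betaPlane.2 ⟨p, h0.symm⟩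
    · exact σ.mem_betaPlane.2 ⟨c • p', by rw [h1, vec_smul_left, vec_smul_right]⟩
  · obtain ⟨c, rfl⟩ := exists_smul_eq_of_eps_eq_zero hp h01
    refine .inl ⟨p, hp, Submodule.eq_of_le_of_finrank_le (hspan _ ?_ ?_)
      (hP ▸ σ.finrank_alphaPlane_le p)⟩
    · exact σ.mem_alphaPlane.2 ⟨m, h0.symm⟩
    · exact σ.mem_alphaPlane.2 ⟨c • m', by rw [h1, vec_smul_left, vec_smul_right]⟩

/-- The volume of four vectors in terms of their spinor components. -/
lemma vol_vec (l p : Fin 4 → Fin 2 → ℝ) :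
    (vol.form x fun i ↦ σ.vec (l i) (p i)) = Matrix.det (Matrix.of fun i ↦
      ![l i 0 * p i 0, l i 1 * p i 0, l i 0 * p i 1, l i 1 * p i 1]) := by
  have key : ∀ l p : Fin 2 → ℝ, σ.vec l p = (l 0 * p 0) • σ.vec ![1, 0] ![1, 0]
      + (l 1 * p 0) • σ.vec ![0, 1] ![1, 0] + (l 0 * p 1) • σ.vec ![1, 0] ![0, 1]
      + (l 1 * p 1) • σ.vec ![0, 1] ![0, 1] := by
    intro l p
    have hl : ∀ l : Fin 2 → ℝ, l = l 0 • ![1, 0] + l 1 • ![0, 1] := by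
      intro l; ext i; fin_cases i <;> simp
    conv_lhs => rw [hl l, hl p]
    simp only [vec_add_left, vec_add_right, vec_smul_left, vec_smul_right, smul_add, smul_smul]
    module
  have := map_sum_smul_eq_det (vol.form x) ![σ.vec ![1, 0] ![1, 0], σ.vec ![0, 1] ![1, 0],
    σ.vec ![1, 0] ![0, 1], σ.vec ![0, 1] ![0, 1]] (fun i ↦
      ![l i 0 * p i 0, l i 1 * p i 0, l i 0 * p i 1, l i 1 * p i 1])
  have ho : vol.form x ![σ.vec ![1, 0] ![1, 0], σ.vec ![0, 1] ![1, 0],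
    σ.vec ![1, 0] ![0, 1], σ.vec ![0, 1] ![0, 1]] = 1 := σ.oriented
  rw [ho, mul_one] at this
  rw [← this]
  congr 1
  ext1 i
  rw [key (l i) (p i)]
  simp [Fin.sum_univ_four]

/-- With `eps l m = 1`, evaluate on `m ⊗ S'` against `l ⊗ S'` in the standard basis of `S'`: the
volume is `-(eps m l)^2 = -1`, while self-duality would require `1`. -/
lemma not_isAlphaPlane_betaPlane {l : Fin 2 → ℝ} (hl : l ≠ 0) :
    ¬ IsAlphaPlane vol x (σ.betaPlane l) := by
  intro H
  obtain ⟨m, hm⟩ := exists_eps_eq_one hl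
  have h1 := H.selfDual _ (σ.mem_betaPlane.2 ⟨![1, 0], rfl⟩) _ (σ.mem_betaPlane.2 ⟨![0, 1], rfl⟩)
    (σ.vec m ![1, 0]) (σ.vec m ![0, 1])
  have h2 := σ.vol_vec ![m, m, l, l] ![![1, 0], ![0, 1], ![1, 0], ![0, 1]]
  have h3 : (fun i ↦ σ.vec ((![m, m, l, l] : Fin 4 → Fin 2 → ℝ) i)
      ((![![1, 0], ![0, 1], ![1, 0], ![0, 1]] : Fin 4 → Fin 2 → ℝ) i))
      = ![σ.vec m ![1, 0], σ.vec m ![0, 1], σ.vec l ![1, 0], σ.vec l ![0, 1]] := by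
    ext1 i; fin_cases i <;> rfl
  rw [h3, h1] at h2
  simp only [form_vec, hm] at h2
  simp [Matrix.det_succ_row_zero, Fin.sum_univ_succ, Fin.succAbove, eps] at h2 hm
  nlinarith

/-- The mirror computation, with `eps p q = 1`: the volume is `(eps p q)^2 = 1`, while
anti-self-duality would require `-1`. -/
lemma not_isBetaPlane_alphaPlane {p : Fin 2 → ℝ} (hp : p ≠ 0) :
    ¬ IsBetaPlane vol x (σ.alphaPlane p) := by
  intro H
  obtain ⟨q, hq⟩ := exists_eps_eq_one hp
  have h1 := H.antiSelfDual _ (σ.mem_alphaPlane.2 ⟨![1, 0], rfl⟩) _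
    (σ.mem_alphaPlane.2 ⟨![0, 1], rfl⟩) (σ.vec ![1, 0] q) (σ.vec ![0, 1] q)
  have h2 := σ.vol_vec ![![1, 0], ![0, 1], ![1, 0], ![0, 1]] ![q, q, p, p]
  have h3 : (fun i ↦ σ.vec ((![![1, 0], ![0, 1], ![1, 0], ![0, 1]] : Fin 4 → Fin 2 → ℝ) i)
      ((![q, q, p, p] : Fin 4 → Fin 2 → ℝ) i))
      = ![σ.vec ![1, 0] q, σ.vec ![0, 1] q, σ.vec ![1, 0] p, σ.vec ![0, 1] p] := by
    ext1 i; fin_cases i <;> rfl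
  rw [h3, h1] at h2
  simp only [form_vec, hq] at h2
  simp [Matrix.det_succ_row_zero, Fin.sum_univ_succ, Fin.succAbove, eps] at h2 hq
  nlinarith

lemma exists_eq_alphaPlane {P : Submodule ℝ (TangentSpace (𝓡 4) x)} (hP : IsAlphaPlane vol x P) :
    ∃ p, p ≠ 0 ∧ P = σ.alphaPlane p := by
  rcases σ.eq_alphaPlane_or_eq_betaPlane hP.finrank_eq hP.null with H | ⟨l, hl, rfl⟩
  · exact H
  · exact (σ.not_isAlphaPlane_betaPlane hl hP).elim

lemma exists_eq_betaPlane {P : Submodule ℝ (TangentSpace (𝓡 4) x)} (hP : IsBetaPlane vol x P) :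
    ∃ l, l ≠ 0 ∧ P = σ.betaPlane l := by
  rcases σ.eq_alphaPlane_or_eq_betaPlane hP.finrank_eq hP.null with ⟨p, hp, rfl⟩ | H
  · exact (σ.not_isBetaPlane_alphaPlane hp hP).elim
  · exact H

lemma alphaPlane_inf_betaPlane {p l : Fin 2 → ℝ} (hp : p ≠ 0) (hl : l ≠ 0) :
    σ.alphaPlane p ⊓ σ.betaPlane l = Submodule.span ℝ {σ.vec l p} := by
  apply le_antisymm
  · rintro u ⟨hu, hu'⟩
    obtain ⟨m, rfl⟩ := σ.mem_alphaPlane.1 hu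
    obtain ⟨n, hn⟩ := σ.mem_betaPlane.1 hu'
    obtain ⟨q, hq⟩ := exists_eps_eq_one hp
    -- The common vector is `m ⊗ p = l ⊗ n`. Paired with `l ⊗ q`, the second form gives `0` and the
    -- first gives `eps m l`, so `m` is proportional to `l`.
    have h1 := σ.form_vec l n l q
    rw [hn, form_vec, hq, eps_self] at h1
    have h2 : eps l m = 0 := by simp only [eps] at h1 ⊢; linarith
    obtain ⟨c, rfl⟩ := exists_smul_eq_of_eps_eq_zero hl h2
    exact Submodule.mem_span_singleton.2 ⟨c, (σ.vec_smul_left c l p).symm⟩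
  · rw [Submodule.span_le, Set.singleton_subset_iff]
    exact ⟨σ.mem_alphaPlane.2 ⟨l, rfl⟩, σ.mem_betaPlane.2 ⟨p, rfl⟩⟩

end SpinFrame

/-! ### Ranks of intersections and orthogonal complements -/

lemma finrank_alpha_inf_beta {P Q : Submodule ℝ (TangentSpace (𝓡 4) x)}
    (hP : IsAlphaPlane vol x P) (hQ : IsBetaPlane vol x Q) :
    Module.finrank ℝ (P ⊓ Q : Submodule ℝ (TangentSpace (𝓡 4) x)) = 1 := by
  obtain ⟨σ⟩ := SpinFrame.nonempty vol x
  obtain ⟨p, hp, rfl⟩ := σ.exists_eq_alphaPlane hP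
  obtain ⟨l, hl, rfl⟩ := σ.exists_eq_betaPlane hQ
  rw [σ.alphaPlane_inf_betaPlane hp hl]
  exact finrank_span_singleton (σ.vec_ne_zero hl hp)

/-- The metric at a point as a bilinear form. -/
noncomputable def NeutralMetric.bilin (h : NeutralMetric M) (x : M) :
    LinearMap.BilinForm ℝ (TangentSpace (𝓡 4) x) :=
  (ContinuousLinearMap.coeLM ℝ).comp (h.form x).toLinearMap

lemma NeutralMetric.orthogonal_eq (D : PlaneField M) (x : M) :
    h.orthogonal D x = (h.bilin x).orthogonal (D x) := by
  ext v
  exact forall₂_congr fun w _ ↦ by rw [h.symm]; rfl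

lemma NeutralMetric.finrank_orthogonal (D : PlaneField M) (x : M) :
    Module.finrank ℝ (h.orthogonal D x) = 4 - Module.finrank ℝ (D x) := by
  rw [h.orthogonal_eq, LinearMap.BilinForm.finrank_orthogonal, finrank_tangentSpace]
  have hs : (h.bilin x).IsRefl := fun u v huv ↦ (h.symm x v u).trans huv
  exact hs.nondegenerate_iff_separatingLeft.2 (h.nondegenerate x)

/-- A totally null plane is its own orthogonal complement. -/
lemma NeutralMetric.orthogonal_eq_self {Z : PlaneField M} (hZ : Module.finrank ℝ (Z x) = 2)
    (hn : h.IsTotallyNull x (Z x)) : h.orthogonal Z x = Z x := by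
  have hle : Z x ≤ h.orthogonal Z x := fun v hv w hw ↦ hn v hv w hw
  refine (Submodule.eq_of_le_of_finrank_eq hle ?_).symm
  rw [h.finrank_orthogonal, hZ]

/-! ### Smooth sections -/

lemma SmoothOn.diffAt {X : VField (𝓡 4) M} {U : Set M} {x : M} (hX : SmoothOn X U) (hU : IsOpen U)
    (hx : x ∈ U) : DiffAt X x :=
  (hX.contMDiffAt (hU.mem_nhds hx)).mdifferentiableAt (by simp)

lemma SmoothOn.contMDiffOn_form {X Y : VField (𝓡 4) M} {U : Set M} (hX : SmoothOn X U)
    (hY : SmoothOn Y U) :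
    ContMDiffOn (𝓡 4) 𝓘(ℝ) ∞ (fun x ↦ h.form x (X x) (Y x)) U := by
  have : ContMDiffOn (𝓡 4) ((𝓡 4).prod 𝓘(ℝ)) ∞
      (fun m ↦ Bundle.TotalSpace.mk' ℝ (E := Bundle.Trivial M ℝ) m (h.form m (X m) (Y m))) U :=
    ContMDiffOn.clm_bundle_apply₂ (F₁ := E4) (F₂ := E4) h.contMDiff.contMDiffOn hX hY
  exact fun x hx ↦ (Bundle.contMDiffWithinAt_totalSpace.1 (this x hx)).2

lemma IsSectionOn.inf_left {D D' : PlaneField M} {X : VField (𝓡 4) M} {U : Set M}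
    (hX : IsSectionOn (fun x ↦ D x ⊓ D' x) X U) : IsSectionOn D X U :=
  ⟨hX.1, fun x hx ↦ (hX.2 x hx).1⟩

lemma IsSectionOn.inf_right {D D' : PlaneField M} {X : VField (𝓡 4) M} {U : Set M}
    (hX : IsSectionOn (fun x ↦ D x ⊓ D' x) X U) : IsSectionOn D' X U :=
  ⟨hX.1, fun x hx ↦ (hX.2 x hx).2⟩

lemma IsSectionOn.mono {D : PlaneField M} {X : VField (𝓡 4) M} {U V : Set M}
    (hX : IsSectionOn D X U) (hVU : V ⊆ U) : IsSectionOn D X V :=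
  ⟨ContMDiffOn.mono hX.1 hVU, fun x hx ↦ hX.2 x (hVU hx)⟩

/-- Every vector of a smooth distribution extends to a local section. -/
lemma IsDistribution.exists_section {k : ℕ} {D : PlaneField M} (hD : IsDistribution k D) {x : M}
    {v : TangentSpace (𝓡 4) x} (hv : v ∈ D x) :
    ∃ (U : Set M) (X : VField (𝓡 4) M), IsOpen U ∧ x ∈ U ∧ IsSectionOn D X U ∧ X x = v := by
  obtain ⟨U, hU, hx, X, hX, hspan⟩ := hD x
  rw [← (hspan x hx).2, Submodule.mem_span_range_iff_exists_fun] at hv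
  obtain ⟨c, rfl⟩ := hv
  -- The coefficients of `v` in the frame at `x` are kept constant over `U`.
  refine ⟨U, fun y ↦ ∑ i, c i • X i y, hU, hx, ⟨?_, fun y hy ↦ ?_⟩, rfl⟩
  · exact ContMDiffOn.sum_section fun i _ ↦ ContMDiffOn.const_smul_section (hX i)
  · rw [← (hspan y hy).2]
    exact Submodule.sum_mem _ fun i _ ↦
      Submodule.smul_mem _ _ (Submodule.subset_span (Set.mem_range_self i))

/-! ### The line field `Z ∩ W` and its orthogonal complement -/

/-- Where `h(X i, Y j) ≠ 0`, the line `Z ∩ W` is spanned by the combination of `X 0`, `X 1`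
orthogonal to `Y j`. -/
lemma span_eq_inf {x : M} {Z W : Submodule ℝ (TangentSpace (𝓡 4) x)}
    (hW : h.IsTotallyNull x W) (h1 : Module.finrank ℝ (Z ⊓ W : Submodule ℝ _) = 1)
    {X : Fin 2 → TangentSpace (𝓡 4) x} (hX : LinearIndependent ℝ X)
    (hZ : Submodule.span ℝ (Set.range X) = Z) {y : TangentSpace (𝓡 4) x} (hy : y ∈ W)
    {i : Fin 2} (hi : h.form x (X i) y ≠ 0) :
    h.form x (X 1) y • X 0 - h.form x (X 0) y • X 1 ≠ 0 ∧
      Submodule.span ℝ {h.form x (X 1) y • X 0 - h.form x (X 0) y • X 1} = Z ⊓ W := by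
  set s := h.form x (X 1) y • X 0 - h.form x (X 0) y • X 1 with hs
  have hs0 : s ≠ 0 := by
    intro H
    have := Fintype.linearIndependent_iff.1 hX ![h.form x (X 1) y, -h.form x (X 0) y] (by
      simpa [Fin.sum_univ_two, hs, sub_eq_add_neg] using H)
    have h0 := this 0
    have h1 := this 1
    simp only [Matrix.cons_val_zero, Matrix.cons_val_one, neg_eq_zero] at h0 h1
    fin_cases i
    · exact hi h1
    · exact hi h0
  refine ⟨hs0, ?_⟩
  have hle : Z ⊓ W ≤ Submodule.span ℝ {s} := by
    rintro d ⟨hdZ, hdW⟩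
    rw [← hZ] at hdZ
    obtain ⟨c, rfl⟩ := (Submodule.mem_span_range_iff_exists_fun ℝ).1 hdZ
    -- Nullity of `W` gives `c 0 * h(X 0, y) + c 1 * h(X 1, y) = 0`, which makes `c` proportional to
    -- the coefficients of `s`. This inclusion suffices, since both sides have rank one.
    have := hW _ hdW _ hy
    simp only [Fin.sum_univ_two, map_add, map_smul, add_apply, smul_apply, smul_eq_mul] at this
    rw [Submodule.mem_span_singleton, Fin.sum_univ_two]
    by_cases h0 : h.form x (X 0) y = 0
    · have h1 : h.form x (X 1) y ≠ 0 := by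
        fin_cases i
        · exact (hi h0).elim
        · exact hi
      have hc : c 1 = 0 := by simpa [h0, h1] using this
      exact ⟨c 0 / h.form x (X 1) y, by simp [hs, h0, hc, smul_smul, h1]⟩
    · refine ⟨-(c 1 / h.form x (X 0) y), ?_⟩
      have hc : -(c 1 / h.form x (X 0) y) * h.form x (X 1) y = c 0 := by
        field_simp
        linarith
      rw [hs, smul_sub, smul_smul, smul_smul, hc]
      simp [h0]
  exact (Submodule.eq_of_le_of_finrank_eq hle (by rw [h1, finrank_span_singleton hs0])).symm

/-- A vector of the null plane `Z` would be orthogonal to every `X i`, so `y` lies outside `Z`. -/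
lemma linearIndependent_triple {x : M} {Z : Submodule ℝ (TangentSpace (𝓡 4) x)}
    (hn : h.IsTotallyNull x Z) {X : Fin 2 → TangentSpace (𝓡 4) x} (hX : LinearIndependent ℝ X)
    (hZ : Submodule.span ℝ (Set.range X) = Z) {y : TangentSpace (𝓡 4) x}
    {i : Fin 2} (hi : h.form x (X i) y ≠ 0) :
    LinearIndependent ℝ (Fin.cons y X : Fin 3 → TangentSpace (𝓡 4) x) := by
  refine linearIndependent_finCons.2 ⟨hX, fun hy ↦ hi ?_⟩
  rw [hZ] at hy
  exact hn _ (hZ ▸ Submodule.subset_span (Set.mem_range_self i)) _ hy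

/-- Both null planes are orthogonal to their intersection, and three independent vectors fill its
complement, of rank `4 - 1`. -/
lemma span_triple_eq_orthogonal {x : M} {Z W : PlaneField M}
    (hZn : h.IsTotallyNull x (Z x)) (hWn : h.IsTotallyNull x (W x))
    (h1 : Module.finrank ℝ (Z x ⊓ W x : Submodule ℝ _) = 1)
    {X : Fin 2 → TangentSpace (𝓡 4) x} (hZ : Submodule.span ℝ (Set.range X) = Z x)
    {y : TangentSpace (𝓡 4) x} (hy : y ∈ W x)
    (hli : LinearIndependent ℝ (Fin.cons y X : Fin 3 → TangentSpace (𝓡 4) x)) :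
    Submodule.span ℝ (Set.range (Fin.cons y X : Fin 3 → TangentSpace (𝓡 4) x))
      = h.orthogonal (fun x ↦ Z x ⊓ W x) x := by
  refine Submodule.eq_of_le_of_finrank_eq (Submodule.span_le.2 ?_) ?_
  · rintro _ ⟨i, rfl⟩ w hw
    refine Fin.cases ?_ (fun i ↦ ?_) i
    · exact hWn _ hy _ hw.2
    · exact hZn _ (hZ ▸ Submodule.subset_span (Set.mem_range_self i)) _ hw.1
  · rw [finrank_span_eq_card hli, h.finrank_orthogonal, h1]
    simp

/-- Near each point there are frames of `Z` and `W` and a nowhere vanishing `h(X i, Y j)`. -/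
lemma exists_frame_form_ne_zero {Z W : PlaneField M} (hZ : IsAlphaDistribution vol Z)
    (hW : IsBetaDistribution vol W) (x₀ : M) :
    ∃ U : Set M, IsOpen U ∧ x₀ ∈ U ∧ ∃ (X : Fin 2 → VField (𝓡 4) M) (Y : VField (𝓡 4) M),
      (∀ i, SmoothOn (X i) U) ∧ SmoothOn Y U ∧ ∀ x ∈ U, LinearIndependent ℝ (fun i ↦ X i x) ∧
        Submodule.span ℝ (Set.range fun i ↦ X i x) = Z x ∧ Y x ∈ W x ∧
        ∃ i, h.form x (X i x) (Y x) ≠ 0 := by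
  obtain ⟨U, hU, hxU, X, hX, hXs⟩ := hZ.1 x₀
  obtain ⟨V, hV, hxV, Y, hY, hYs⟩ := hW.1 x₀
  -- If all pairings vanished, then `Z ≤ W^⊥ = W` at `x₀`, and the intersection would have rank two
  -- instead of one.
  have : ∃ i j, h.form x₀ (X i x₀) (Y j x₀) ≠ 0 := by
    by_contra! H
    have hle : Z x₀ ≤ h.orthogonal W x₀ := by
      rw [← (hXs x₀ hxU).2, Submodule.span_le]
      rintro _ ⟨i, rfl⟩ w hw
      rw [← (hYs x₀ hxV).2] at hw
      induction hw using Submodule.span_induction with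
      | mem w hw => obtain ⟨j, rfl⟩ := hw; exact H i j
      | zero => simp
      | add u v _ _ hu hv => simp [hu, hv]
      | smul c u _ hu => simp [hu]
    rw [h.orthogonal_eq_self (hW.2 x₀).finrank_eq (hW.2 x₀).null] at hle
    have := finrank_alpha_inf_beta (hZ.2 x₀) (hW.2 x₀)
    rw [inf_eq_left.2 hle, (hZ.2 x₀).finrank_eq] at this
    omega
  obtain ⟨i, j, hij⟩ := this
  have hX' : ∀ i, SmoothOn (X i) (U ∩ V) := fun i ↦ ContMDiffOn.mono (hX i) Set.inter_subset_left
  have hY' : SmoothOn (Y j) (U ∩ V) := ContMDiffOn.mono (hY j) Set.inter_subset_right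
  -- The pairing is continuous, so the indices `i`, `j` found at `x₀` work on a whole neighbourhood.
  refine ⟨(U ∩ V) ∩ (fun x ↦ h.form x (X i x) (Y j x)) ⁻¹' {0}ᶜ,
    ((hX' i).contMDiffOn_form hY').continuousOn.isOpen_inter_preimage (hU.inter hV)
      isOpen_compl_singleton, ⟨⟨hxU, hxV⟩, hij⟩, X, Y j,
    fun i ↦ ContMDiffOn.mono (hX' i) Set.inter_subset_left,
    ContMDiffOn.mono hY' Set.inter_subset_left, fun x hx ↦
    ⟨(hXs x hx.1.1).1, (hXs x hx.1.1).2, ?_, i, hx.2⟩⟩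
  rw [← (hYs x hx.1.2).2]
  exact Submodule.subset_span (Set.mem_range_self j)

/-- The generator of `span_eq_inf` has smooth coefficients, being pairings of smooth fields. -/
theorem isDistribution_inf {Z W : PlaneField M} (hZ : IsAlphaDistribution vol Z)
    (hW : IsBetaDistribution vol W) : IsDistribution 1 (fun x ↦ Z x ⊓ W x) := by
  intro x₀
  obtain ⟨U, hU, hx₀, X, Y, hX, hY, H⟩ := exists_frame_form_ne_zero hZ hW x₀
  refine ⟨U, hU, hx₀, fun _ x ↦ h.form x (X 1 x) (Y x) • X 0 x - h.form x (X 0 x) (Y x) • X 1 x,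
    fun _ ↦ ?_, fun x hx ↦ ?_⟩
  · exact ContMDiffOn.sub_section
      (ContMDiffOn.smul_section ((hX 1).contMDiffOn_form hY) (hX 0))
      (ContMDiffOn.smul_section ((hX 0).contMDiffOn_form hY) (hX 1))
  · obtain ⟨hli, hsp, hYx, i, hi⟩ := H x hx
    obtain ⟨h0, h1⟩ := span_eq_inf (hW.2 x).null (finrank_alpha_inf_beta (hZ.2 x) (hW.2 x))
      hli hsp hYx hi
    refine ⟨linearIndependent_unique_iff.2 h0, ?_⟩
    rw [Set.range_const]
    exact h1

theorem isDistribution_orthogonal_inf {Z W : PlaneField M} (hZ : IsAlphaDistribution vol Z)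
    (hW : IsBetaDistribution vol W) : IsDistribution 3 (h.orthogonal fun x ↦ Z x ⊓ W x) := by
  intro x₀
  obtain ⟨U, hU, hx₀, X, Y, hX, hY, H⟩ := exists_frame_form_ne_zero hZ hW x₀
  refine ⟨U, hU, hx₀, Fin.cons Y X, fun i ↦ Fin.cases hY hX i, fun x hx ↦ ?_⟩
  obtain ⟨hli, hsp, hYx, i, hi⟩ := H x hx
  have he : (fun i ↦ (Fin.cons Y X : Fin 3 → VField (𝓡 4) M) i x)
      = Fin.cons (Y x) (fun i ↦ X i x) := by
    ext1 i
    refine Fin.cases rfl (fun i ↦ rfl) i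
  have hli3 := linearIndependent_triple (hZ.2 x).null hli hsp hi
  rw [he]
  exact ⟨hli3, span_triple_eq_orthogonal (hZ.2 x).null (hW.2 x).null
    (finrank_alpha_inf_beta (hZ.2 x) (hW.2 x)) hsp hYx hli3⟩

/-! ### Parallelism -/

omit [IsManifold (𝓡 4) ∞ M] in
lemma mvfderiv_eq_zero_of_eqOn {f : M → ℝ} {U : Set M} {x : M} (hU : IsOpen U) (hx : x ∈ U)
    (hf : ∀ y ∈ U, f y = 0) : mvfderiv (𝓡 4) f x = 0 := by
  have : f =ᶠ[𝓝 x] fun _ ↦ 0 := Filter.eventuallyEq_of_mem (hU.mem_nhds hx) hf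
  rw [mvfderiv, this.mfderiv_eq, mfderiv_const]
  exact ContinuousLinearMap.comp_zero _

/-- An integrable distribution of totally null planes of half the dimension is auto-parallel. -/
theorem NeutralMetric.isAutoParallel_of_isIntegrable {Z : PlaneField M} (hZ : IsDistribution 2 Z)
    (hr : ∀ x, Module.finrank ℝ (Z x) = 2) (hn : ∀ x, h.IsTotallyNull x (Z x))
    (hi : IsIntegrable Z) : h.IsAutoParallel Z := by
  intro U Y hU hY x hx v hv
  -- Since `Z = Z^⊥`, membership in `Z` is tested by pairing with vectors of `Z`, which extend to
  -- sections and so can enter the Koszul formula.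
  rw [← h.orthogonal_eq_self (hr x) (hn x)]
  intro w hw
  obtain ⟨U₁, X, hU₁, hx₁, hX, rfl⟩ := hZ.exists_section hv
  obtain ⟨U₂, T, hU₂, hx₂, hT, rfl⟩ := hZ.exists_section hw
  have hV : IsOpen (U ∩ U₁ ∩ U₂) := (hU.inter hU₁).inter hU₂
  have hxV : x ∈ U ∩ U₁ ∩ U₂ := ⟨⟨hx, hx₁⟩, hx₂⟩
  replace hY := hY.mono (fun y (hy : y ∈ U ∩ U₁ ∩ U₂) ↦ hy.1.1)
  replace hX := hX.mono (fun y (hy : y ∈ U ∩ U₁ ∩ U₂) ↦ hy.1.2)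
  replace hT := hT.mono (fun y (hy : y ∈ U ∩ U₁ ∩ U₂) ↦ hy.2)
  have hd : ∀ {A B : VField (𝓡 4) M}, IsSectionOn Z A (U ∩ U₁ ∩ U₂) →
      IsSectionOn Z B (U ∩ U₁ ∩ U₂) →
      mvfderiv (𝓡 4) (fun y ↦ h.form y (A y) (B y)) x = 0 := fun hA hB ↦
    mvfderiv_eq_zero_of_eqOn hV hxV fun y hy ↦ hn y _ (hA.2 y hy) _ (hB.2 y hy)
  have hb : ∀ {A B C : VField (𝓡 4) M}, IsSectionOn Z A (U ∩ U₁ ∩ U₂) →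
      IsSectionOn Z B (U ∩ U₁ ∩ U₂) → IsSectionOn Z C (U ∩ U₁ ∩ U₂) →
      h.form x (VectorField.mlieBracket (𝓡 4) A B x) (C x) = 0 := fun hA hB hC ↦
    hn x _ (hi _ _ _ hV hA hB x hxV) _ (hC.2 x hxV)
  have := h.leviCivitaFun_spec (hY.1.diffAt hV hxV) (hX.1.diffAt hV hxV) (hT.1.diffAt hV hxV)
  -- The three derivative terms differentiate functions that vanish on the neighbourhood; in the
  -- three bracket terms integrability keeps the bracket in the null plane.
  rw [PseudoMetric.koszul, hd hY hT, hd hX hT, hd hX hY, hb hX hY hT, hb hX hT hY,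
    hb hY hT hX] at this
  change h.form x (h.leviCivitaFun Y x (X x)) (T x) = 0
  simpa using this

/-- The orthogonal complement of a parallel distribution is parallel. -/
theorem NeutralMetric.IsParallel.orthogonal {k : ℕ} {D : PlaneField M} (hD : IsDistribution k D)
    (hp : h.IsParallel D) : h.IsParallel (h.orthogonal D) := by
  intro U Y hU hY x hx v w hw
  obtain ⟨U₁, X, hU₁, hx₁, hX, rfl⟩ := hD.exists_section hw
  -- Differentiate `h(Y, X) = 0` along `v`: the term `h(Y, ∇_v X)` vanishes because `∇_v X` stays in
  -- `D`, leaving `h(∇_v Y, X) = 0`.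
  have h1 := h.isLeviCivita_leviCivita.metric v (hY.1.diffAt hU hx) (hX.1.diffAt hU₁ hx₁)
  rw [mvfderiv_eq_zero_of_eqOn (hU.inter hU₁) ⟨hx, hx₁⟩
    fun y hy ↦ hY.2 y hy.1 _ (hX.2 y hy.2)] at h1
  have h2 := hY.2 x hx _ (hp U₁ X hU₁ hX x hx₁ v)
  rw [h2] at h1
  simpa using h1.symm

theorem NeutralMetric.IsParallel.inf {D D' : PlaneField M} (hD : h.IsParallel D)
    (hD' : h.IsParallel D') : h.IsParallel fun x ↦ D x ⊓ D' x :=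
  fun U Y hU hY x hx v ↦ ⟨hD U Y hU hY.inf_left x hx v, hD' U Y hU hY.inf_right x hx v⟩

theorem NeutralMetric.IsAutoParallel.inf {D D' : PlaneField M} (hD : h.IsAutoParallel D)
    (hD' : h.IsAutoParallel D') : h.IsAutoParallel fun x ↦ D x ⊓ D' x :=
  fun U Y hU hY x hx v hv ↦
    ⟨hD U Y hU hY.inf_left x hx v hv.1, hD' U Y hU hY.inf_right x hx v hv.2⟩

end AlphaBeta

theorem lemma2p2 {M : Type*} [TopologicalSpace M] [ChartedSpace AlphaBeta.E4 M]
    [IsManifold (𝓡 4) ∞ M] (h : AlphaBeta.NeutralMetric M) (vol : h.VolumeForm)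
    (Z W D H : AlphaBeta.PlaneField M)
    (hD : D = fun x ↦ Z x ⊓ W x) (hH : H = h.orthogonal D) :
    (AlphaBeta.IsAlphaDistribution vol Z → AlphaBeta.IsBetaDistribution vol W →
      AlphaBeta.IsDistribution 1 D ∧ AlphaBeta.IsDistribution 3 H ∧
      (∀ x, h.IsTotallyNull x (D x)) ∧
      ∀ (x : M) (σ : AlphaBeta.SpinFrame vol x), ∃ p l : Fin 2 → ℝ, p ≠ 0 ∧ l ≠ 0 ∧
        Z x = σ.alphaPlane p ∧ W x = σ.betaPlane l ∧ D x = Submodule.span ℝ {σ.vec l p}) ∧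
    (AlphaBeta.IsAlphaBetaGeometry vol Z W → h.IsAutoParallel D) ∧
    (AlphaBeta.IsTwoSidedWalker vol Z W → h.IsParallel D ∧ h.IsParallel H) := by
  subst hD hH
  refine ⟨fun hZ hW ↦ ⟨AlphaBeta.isDistribution_inf hZ hW,
    AlphaBeta.isDistribution_orthogonal_inf hZ hW,
    fun x u hu v hv ↦ (hZ.2 x).null u hu.1 v hv.1, fun x σ ↦ ?_⟩, fun hg ↦ ?_, fun hw ↦ ?_⟩
  · obtain ⟨p, hp, hZp⟩ := σ.exists_eq_alphaPlane (hZ.2 x)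
    obtain ⟨l, hl, hWl⟩ := σ.exists_eq_betaPlane (hW.2 x)
    exact ⟨p, l, hp, hl, hZp, hWl, by
      simp only [hZp, hWl]; exact σ.alphaPlane_inf_betaPlane hp hl⟩
  · exact (AlphaBeta.NeutralMetric.isAutoParallel_of_isIntegrable hg.alpha.1
      (fun x ↦ (hg.alpha.2 x).finrank_eq) (fun x ↦ (hg.alpha.2 x).null) hg.integrable_alpha).inf
      (AlphaBeta.NeutralMetric.isAutoParallel_of_isIntegrable hg.beta.1
      (fun x ↦ (hg.beta.2 x).finrank_eq) (fun x ↦ (hg.beta.2 x).null) hg.integrable_beta)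
  · have hp := hw.parallel_alpha.inf hw.parallel_beta
    -- Smoothness of the line field is needed here to extend its vectors to local sections.
    exact ⟨hp, hp.orthogonal (AlphaBeta.isDistribution_inf hw.alpha hw.beta)⟩
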